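/- Let $\Bbbk$ be a field that is complete with respect to a nontrivial non-archimedean absolute value $|\cdot|$. Extend $|\cdot|$ to the algebraic closure $\overline{\Bbbk}$, put $v=-\log|\cdot|$ and $\Gamma=v(\overline{\Bbbk}^{\times})\subset\mathbb R$. Let $\Delta\subset\mathbb R^d$ be a nonempty bounded $\Gamma$-rational convex polyhedron, i.e. a nonempty bounded set of the form $\{u\in\mathbb R^d:\sum_{j=1}^d b_{ij}u_j\ge c_i,\ i=1,\dots,r\}$ with $b_{ij}\in\mathbb Z$ and $c_i\in\Gamma$. Let $\Bbbk\langle\!\langle\mathrm{val}^{-1}(\Delta)\rangle\!\rangle$ be the ring of formal Laurent series $f=\sum_{n\in\mathbb Z^d}a_n x^n$ with $a_n\in\Bbbk$ such that, for every $u\in\Delta$, $v(a_n)+n\cdot u\to\infty$ as $\|n\|\to\infty$, equipped with the norm $$|f|=\exp\Bigl(-\inf\{v(a_n)+n\cdot u: n\in\mathbb Z^d,\ u\in\Delta\}\Bigr)=\sup_{n\in\mathbb Z^d,\,u\in\Delta}|a_n|e^{-n\cdot u}.$$ For $m\ge0$ let $T_m=\Bbbk\langle\!\langle y_1,\dots,y_m\rangle\!\rangle$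 be the Tate algebra of formal power series $\sum_{k\in\mathbb Z_{\ge0}^m}a_k y^k$ with $|a_k|\to0$ as $\|k\|\to\infty$, with the norm $\max_k|a_k|$. Then $\Bbbk\langle\!\langle\mathrm{val}^{-1}(\Delta)\rangle\!\rangle$ is an affinoid algebra: it is a $\Bbbk$-Banach algebra (a complete non-archimedean normed $\Bbbk$-algebra whose norm extends that of $\Bbbk$), and for some $m$ there is a continuous surjective homomorphism of $\Bbbk$-algebras $T_m\to\Bbbk\langle\!\langle\mathrm{val}^{-1}(\Delta)\rangle\!\rangle$. -/

import Mathlib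

open Filter Topology

namespace PolyhedralAffinoid

section TateAlgebra

variable (𝕜 : Type*) [NontriviallyNormedField 𝕜] [IsUltrametricDist 𝕜] (n : ℕ)

/-- The Tate algebra `T_n = 𝕜⟨⟨x₁, …, xₙ⟩⟩`: formal power series `∑ aₘ xᵐ`, `m ∈ ℕⁿ`, with
`‖aₘ‖ → 0` along the cofinite filter (that is, as `|m| → ∞`). -/
def TateAlgebra : Subalgebra 𝕜 (MvPowerSeries (Fin n) 𝕜) where
  __ := (MvPowerSeries.IsRestricted.subring (R := 𝕜) (fun _ : Fin n ↦ (1 : ℝ))).toSubsemiring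
  algebraMap_mem' a := MvPowerSeries.isRestricted_C _ a

variable {𝕜 n}

theorem TateAlgebra.tendsto (f : TateAlgebra 𝕜 n) :
    Tendsto (fun m ↦ ‖MvPowerSeries.coeff m f.1‖) cofinite (𝓝 0) := by
  have h : MvPowerSeries.IsRestricted (fun _ ↦ (1 : ℝ)) f.1 := f.2
  simpa [MvPowerSeries.IsRestricted, Finsupp.prod] using h

theorem TateAlgebra.hasGaussNorm (f : TateAlgebra 𝕜 n) :
    MvPowerSeries.HasGaussNorm (fun a : 𝕜 ↦ ‖a‖) (fun _ ↦ 1) f.1 := by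
  have h : MvPowerSeries.IsRestricted (fun _ ↦ (1 : ℝ)) f.1 := f.2
  exact Filter.Tendsto.bddAbove_range_of_cofinite h

/-- The norm on the Tate algebra is the Gauss norm `|f| = max ‖aₘ‖`. -/
noncomputable def TateAlgebra.ringNorm : RingNorm (TateAlgebra 𝕜 n) where
  toFun f := MvPowerSeries.gaussNorm (fun a : 𝕜 ↦ ‖a‖) (fun _ ↦ 1) f.1
  map_zero' := MvPowerSeries.gaussNorm_zero _ _ norm_zero
  add_le' f g := by
    refine (MvPowerSeries.gaussNorm_add_le_max _ _ f.1 g.1 (fun _ ↦ zero_le_one)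
      (fun _ ↦ norm_nonneg _) IsUltrametricDist.isNonarchimedean_norm
      (TateAlgebra.hasGaussNorm f) (TateAlgebra.hasGaussNorm g)).trans ?_
    exact max_le_add_of_nonneg
      (MvPowerSeries.gaussNorm_nonneg _ _ _ fun _ ↦ norm_nonneg _)
      (MvPowerSeries.gaussNorm_nonneg _ _ _ fun _ ↦ norm_nonneg _)
  neg' f := MvPowerSeries.gaussNorm_neg _ _ norm_neg f.1
  mul_le' f g := MvPowerSeries.gaussNorm_mul_le _ _ f.1 g.1 (fun _ ↦ zero_le_one)
    (fun _ ↦ norm_nonneg _) norm_mul_le IsUltrametricDist.isNonarchimedean_norm norm_zero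
    (TateAlgebra.hasGaussNorm f) (TateAlgebra.hasGaussNorm g)
  eq_zero_of_map_eq_zero' f h := Subtype.ext <|
    (MvPowerSeries.gaussNorm_eq_zero_iff _ _ f.1 norm_zero (fun _ ↦ norm_nonneg _)
      (fun _ ↦ norm_eq_zero.1) (fun _ ↦ zero_lt_one) (TateAlgebra.hasGaussNorm f)).1 h

noncomputable instance : NormedCommRing (TateAlgebra 𝕜 n) where
  __ := TateAlgebra.ringNorm.toNormedRing
  mul_comm := mul_comm

theorem TateAlgebra.norm_def (f : TateAlgebra 𝕜 n) :
    ‖f‖ = ⨆ m, ‖MvPowerSeries.coeff m f.1‖ := by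
  change MvPowerSeries.gaussNorm (fun a : 𝕜 ↦ ‖a‖) (fun _ ↦ 1) f.1 = _
  simp [MvPowerSeries.gaussNorm, Finsupp.prod]

end TateAlgebra

/-- `A` is an affinoid algebra over `𝕜`: it is a `𝕜`-Banach algebra, i.e. a complete
non-archimedean normed algebra whose norm extends that of `𝕜`, and it admits a continuous
epimorphism (surjective homomorphism of `𝕜`-algebras) from some Tate algebra. -/
structure IsAffinoidAlgebra (𝕜 A : Type*) [NontriviallyNormedField 𝕜] [IsUltrametricDist 𝕜]
    [NormedCommRing A] [NormedAlgebra 𝕜 A] : Prop where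
  complete : CompleteSpace A
  ultrametric : IsUltrametricDist A
  norm_algebraMap : ∀ a : 𝕜, ‖algebraMap 𝕜 A a‖ = ‖a‖
  exists_epimorphism : ∃ (n : ℕ) (φ : TateAlgebra 𝕜 n →ₐ[𝕜] A),
    Continuous φ ∧ Function.Surjective φ

/-- `Γ = v(𝕜̄ˣ) ⊆ ℝ`, where `v = -log |·|` and `|·|` is the (unique) extension of the norm of `𝕜`
to its algebraic closure, which is Mathlib's `spectralNorm`. -/
def valueGroup (𝕜 : Type*) [NontriviallyNormedField 𝕜] : Set ℝ :=
  {γ | ∃ a : AlgebraicClosure 𝕜, a ≠ 0 ∧ γ = -Real.log (spectralNorm 𝕜 (AlgebraicClosure 𝕜) a)}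

/-- `Δ ⊆ ℝᵈ` is a `Γ`-rational convex polyhedron: the solution set of a finite system
`∑ⱼ bᵢⱼ uⱼ ≥ cᵢ` with `bᵢⱼ ∈ ℤ` and `cᵢ ∈ Γ`. -/
def IsRationalPolyhedron (𝕜 : Type*) [NontriviallyNormedField 𝕜] {d : ℕ}
    (Δ : Set (Fin d → ℝ)) : Prop :=
  ∃ (r : ℕ) (b : Fin r → Fin d → ℤ) (c : Fin r → ℝ), (∀ i, c i ∈ valueGroup 𝕜) ∧
    Δ = {u | ∀ i, c i ≤ ∑ j, (b i j : ℝ) * u j}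

/-- Nonempty bounded `Γ`-rational polyhedra in `ℝᵈ`. -/
structure BoundedRationalPolyhedron (𝕜 : Type*) [NontriviallyNormedField 𝕜] (d : ℕ) where
  carrier : Set (Fin d → ℝ)
  nonempty : carrier.Nonempty
  bounded : Bornology.IsBounded carrier
  rational : IsRationalPolyhedron 𝕜 carrier

/-- A bounded polyhedron contains finitely many points (its vertices) such that every linear
functional is minimized over the polyhedron at one of them. -/
theorem exists_vertices {d r : ℕ} (b : Fin r → Fin d → ℝ) (c : Fin r → ℝ)
    (hb : Bornology.IsBounded {u : Fin d → ℝ | ∀ i, c i ≤ ∑ j, b i j * u j}) :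
    ∃ V : Set (Fin d → ℝ), V.Finite ∧ V ⊆ {u | ∀ i, c i ≤ ∑ j, b i j * u j} ∧
      ∀ w u : Fin d → ℝ, (∀ i, c i ≤ ∑ j, b i j * u j) →
        ∃ v ∈ V, ∑ j, w j * v j ≤ ∑ j, w j * u j := by
  set P : Set (Fin d → ℝ) := {u | ∀ i, c i ≤ ∑ j, b i j * u j} with hP
  have hclosed : IsClosed P := by
    rw [hP, Set.ofPred_forall]
    exact isClosed_iInter fun i ↦ isClosed_le continuous_const (by fun_prop)
  have hcomp : IsCompact P := Metric.isCompact_of_isClosed_isBounded hclosed hb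
  refine ⟨P.extremePoints ℝ, ?_, extremePoints_subset, ?_⟩
  · refine Set.Finite.of_injOn (f := fun x ↦ {i | c i = ∑ j, b i j * x j}) (t := Set.univ)
      (fun _ _ ↦ Set.mem_univ _) ?_ Set.finite_univ
    intro x hx y hy hxy
    have hact : ∀ i, c i = ∑ j, b i j * x j → c i = ∑ j, b i j * y j := fun i hi ↦ by
      exact (Set.ext_iff.1 hxy i).1 hi
    have hlin : ∀ (t : ℝ) i, ∑ j, b i j * (x + t • (x - y)) j =
        (∑ j, b i j * x j) + t * ((∑ j, b i j * x j) - ∑ j, b i j * y j) := by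
      intro t i
      rw [← Finset.sum_sub_distrib, Finset.mul_sum, ← Finset.sum_add_distrib]
      exact Finset.sum_congr rfl fun j _ ↦ by
        simp only [Pi.add_apply, Pi.smul_apply, Pi.sub_apply, smul_eq_mul]; ring
    have hev : ∀ᶠ t : ℝ in 𝓝[>] 0, ∀ i, c i ≤ ∑ j, b i j * (x + t • (x - y)) j := by
      rw [Filter.eventually_all]
      intro i
      simp only [hlin]
      rcases (hx.1 i).eq_or_lt with h | h
      · refine Filter.Eventually.of_forall fun t ↦ ?_
        rw [← h, ← hact i h]; simp
      · have hc : Tendsto (fun t : ℝ ↦ (∑ j, b i j * x j) +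
            t * ((∑ j, b i j * x j) - ∑ j, b i j * y j)) (𝓝[>] 0) (𝓝 (∑ j, b i j * x j)) := by
          have : Continuous (fun t : ℝ ↦ (∑ j, b i j * x j) +
            t * ((∑ j, b i j * x j) - ∑ j, b i j * y j)) := by fun_prop
          have h0 := this.tendsto 0
          simp only [zero_mul, add_zero] at h0
          exact h0.mono_left nhdsWithin_le_nhds
        exact (hc.eventually (lt_mem_nhds h)).mono fun _ h ↦ h.le
    obtain ⟨t, ht, ht0⟩ := (hev.and self_mem_nhdsWithin).exists
    have ht0 : 0 < t := ht0
    have hseg : x ∈ openSegment ℝ y (x + t • (x - y)) := by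
      refine ⟨t / (1 + t), 1 / (1 + t), by positivity, by positivity, by field_simp; ring, ?_⟩
      ext j
      simp only [Pi.add_apply, Pi.smul_apply, Pi.sub_apply, smul_eq_mul]
      field_simp; ring
    exact (hx.2 hy.1 ht hseg).symm
  · intro w u hu
    let l : (Fin d → ℝ) →L[ℝ] ℝ := -∑ j, w j • ContinuousLinearMap.proj j
    have hl : ∀ x, l x = -∑ j, w j * x j := fun x ↦ by simp [l]
    have hexp : IsExposed ℝ P (l.toExposed P) := ContinuousLinearMap.toExposed.isExposed
    have hne : (l.toExposed P).Nonempty := by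
      obtain ⟨x, hx, hmax⟩ := hcomp.exists_isMaxOn ⟨u, hu⟩ l.continuous.continuousOn
      exact ⟨x, hx, fun y hy ↦ hmax hy⟩
    obtain ⟨v, hv⟩ := (hexp.isCompact hcomp).extremePoints_nonempty hne
    refine ⟨v, hexp.isExtreme.extremePoints_subset_extremePoints hv, ?_⟩
    have := hv.1.2 u hu
    rw [hl, hl] at this
    linarith

section LaurentAlgebra

variable {𝕜 : Type*} [NontriviallyNormedField 𝕜] [IsUltrametricDist 𝕜] {d : ℕ}

/-- The weight `e^{-n·u}`, so that `-log (‖a‖ * weight u n) = v(a) + n·u`. -/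
noncomputable def weight (u : Fin d → ℝ) (n : Fin d → ℤ) : ℝ := Real.exp (-∑ j, (n j : ℝ) * u j)

theorem weight_pos (u : Fin d → ℝ) (n : Fin d → ℤ) : 0 < weight u n := Real.exp_pos _

theorem weight_zero (u : Fin d → ℝ) : weight u 0 = 1 := by simp [weight]

theorem weight_add (u : Fin d → ℝ) (m n : Fin d → ℤ) :
    weight u (m + n) = weight u m * weight u n := by
  simp only [weight, ← Real.exp_add, Pi.add_apply, Int.cast_add, add_mul, Finset.sum_add_distrib]
  ring_nf

/-- Coefficient families `a` of formal Laurent series `∑ aₙ xⁿ`, `n ∈ ℤᵈ`, such that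
`v(aₙ) + n·u → ∞` as `‖n‖ → ∞` for all `u ∈ Δ`; multiplicatively, `‖aₙ‖ e^{-n·u} → 0`. -/
def laurentSubmodule (𝕜 : Type*) [NontriviallyNormedField 𝕜] [IsUltrametricDist 𝕜]
    (Δ : Set (Fin d → ℝ)) : Submodule 𝕜 ((Fin d → ℤ) → 𝕜) where
  carrier := {a | ∀ u ∈ Δ, Tendsto (fun n ↦ ‖a n‖ * weight u n) cofinite (𝓝 0)}
  zero_mem' u _ := by simpa using tendsto_const_nhds
  add_mem' {a b} ha hb u hu := by
    refine squeeze_zero (fun n ↦ by have := weight_pos u n; positivity) (fun n ↦ ?_)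
      (by simpa using (ha u hu).add (hb u hu))
    rw [← add_mul]
    exact mul_le_mul_of_nonneg_right (norm_add_le _ _) (weight_pos u n).le
  smul_mem' c a ha u hu := by
    simpa [norm_mul, mul_assoc] using (ha u hu).const_mul ‖c‖

/-- The algebra `𝕜⟨⟨val⁻¹(Δ)⟩⟩` of Laurent series converging on `val⁻¹(Δ)`; its elements are
the coefficient families. -/
def LaurentAlgebra (Δ : BoundedRationalPolyhedron 𝕜 d) : Type _ := laurentSubmodule 𝕜 Δ.carrier

namespace LaurentAlgebra

variable {Δ : BoundedRationalPolyhedron 𝕜 d}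

instance : AddCommGroup (LaurentAlgebra Δ) :=
  inferInstanceAs (AddCommGroup (laurentSubmodule 𝕜 Δ.carrier))

instance : Module 𝕜 (LaurentAlgebra Δ) :=
  inferInstanceAs (Module 𝕜 (laurentSubmodule 𝕜 Δ.carrier))

/-- The coefficient of `xⁿ`. -/
def coeff (f : LaurentAlgebra Δ) (n : Fin d → ℤ) : 𝕜 := f.1 n

theorem tendsto (f : LaurentAlgebra Δ) {u : Fin d → ℝ} (hu : u ∈ Δ.carrier) :
    Tendsto (fun n ↦ ‖f.coeff n‖ * weight u n) cofinite (𝓝 0) := f.2 u hu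

@[ext] theorem ext {f g : LaurentAlgebra Δ} (h : ∀ n, f.coeff n = g.coeff n) : f = g :=
  Subtype.ext (funext h)

/-- The Laurent series with a given family of coefficients. -/
def mk (a : (Fin d → ℤ) → 𝕜)
    (ha : ∀ u ∈ Δ.carrier, Tendsto (fun n ↦ ‖a n‖ * weight u n) cofinite (𝓝 0)) :
    LaurentAlgebra Δ := ⟨a, ha⟩

@[simp] theorem coeff_mk (a : (Fin d → ℤ) → 𝕜) (ha) (n : Fin d → ℤ) :
    (mk (Δ := Δ) a ha).coeff n = a n := rfl
@[simp] theorem coeff_zero (n : Fin d → ℤ) : (0 : LaurentAlgebra Δ).coeff n = 0 := rfl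
@[simp] theorem coeff_add (f g : LaurentAlgebra Δ) (n : Fin d → ℤ) :
    (f + g).coeff n = f.coeff n + g.coeff n := rfl
@[simp] theorem coeff_neg (f : LaurentAlgebra Δ) (n : Fin d → ℤ) :
    (-f).coeff n = -f.coeff n := rfl
@[simp] theorem coeff_smul (c : 𝕜) (f : LaurentAlgebra Δ) (n : Fin d → ℤ) :
    (c • f).coeff n = c * f.coeff n := rfl

/-- Term-wise products of two convergent Laurent series tend to `0`. -/
theorem tendsto_prod (f g : LaurentAlgebra Δ) {u : Fin d → ℝ} (hu : u ∈ Δ.carrier) :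
    Tendsto (fun p : (Fin d → ℤ) × (Fin d → ℤ) ↦
      ‖f.coeff p.1 * g.coeff p.2‖ * weight u (p.1 + p.2)) cofinite (𝓝 0) := by
  refine (tendsto_mul_cofinite_nhds_zero (f.tendsto hu) (g.tendsto hu)).congr fun p ↦ ?_
  rw [norm_mul, weight_add]; ring

/-- `‖f‖ = sup {‖aₙ‖ e^{-n·u} : n ∈ ℤᵈ, u ∈ Δ}`, so that `-log ‖f‖` is the infimum of the
`v(aₙ) + n·u`. -/
noncomputable instance : Norm (LaurentAlgebra Δ) where
  norm f := ⨆ p : (Fin d → ℤ) × Δ.carrier, ‖f.coeff p.1‖ * weight p.2 p.1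

theorem norm_def (f : LaurentAlgebra Δ) :
    ‖f‖ = ⨆ p : (Fin d → ℤ) × Δ.carrier, ‖f.coeff p.1‖ * weight p.2 p.1 := rfl

/-- The supremum that defines the norm is finite. -/
theorem bddAbove (f : LaurentAlgebra Δ) : BddAbove (Set.range
    fun p : (Fin d → ℤ) × Δ.carrier ↦ ‖f.coeff p.1‖ * weight p.2 p.1) := by
  obtain ⟨r, b, c, -, hΔ⟩ := Δ.rational
  obtain ⟨V, hV, hVΔ, hmin⟩ := exists_vertices (fun i j ↦ (b i j : ℝ)) c (hΔ ▸ Δ.bounded)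
  have hB : ∀ v : Fin d → ℝ, ∃ B : ℝ, 0 ≤ B ∧ (v ∈ V → ∀ n, ‖f.coeff n‖ * weight v n ≤ B) := by
    intro v
    by_cases hv : v ∈ V
    · have hv' : v ∈ Δ.carrier := hΔ ▸ hVΔ hv
      obtain ⟨B, hB⟩ := (f.tendsto hv').bddAbove_range_of_cofinite
      exact ⟨max B 0, le_max_right _ _, fun _ n ↦ (hB ⟨n, rfl⟩).trans (le_max_left _ _)⟩
    · exact ⟨0, le_rfl, fun h ↦ absurd h hv⟩
  choose B hB0 hB using hB
  refine ⟨∑ v ∈ hV.toFinset, B v, ?_⟩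
  rintro _ ⟨⟨n, u, hu⟩, rfl⟩
  obtain ⟨v, hv, hle⟩ := hmin (fun j ↦ (n j : ℝ)) u (by rw [hΔ] at hu; exact hu)
  calc ‖f.coeff n‖ * weight u n ≤ ‖f.coeff n‖ * weight v n := by
        refine mul_le_mul_of_nonneg_left ?_ (norm_nonneg _)
        exact Real.exp_le_exp.2 (neg_le_neg hle)
    _ ≤ B v := hB v hv n
    _ ≤ _ := Finset.single_le_sum (fun v _ ↦ hB0 v) (hV.mem_toFinset.2 hv)

theorem le_norm (f : LaurentAlgebra Δ) {u : Fin d → ℝ} (hu : u ∈ Δ.carrier) (n : Fin d → ℤ) :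
    ‖f.coeff n‖ * weight u n ≤ ‖f‖ :=
  le_ciSup f.bddAbove (n, ⟨u, hu⟩)

theorem norm_nonneg' (f : LaurentAlgebra Δ) : 0 ≤ ‖f‖ :=
  Real.iSup_nonneg fun _ ↦ mul_nonneg (norm_nonneg _) (weight_pos _ _).le

theorem norm_le {f : LaurentAlgebra Δ} {C : ℝ} (hC : 0 ≤ C)
    (h : ∀ u ∈ Δ.carrier, ∀ n, ‖f.coeff n‖ * weight u n ≤ C) : ‖f‖ ≤ C :=
  Real.iSup_le (fun p ↦ h p.2 p.2.2 p.1) hC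

variable [CompleteSpace 𝕜]

theorem summable_of_weight {ι : Type*} {F : ι → 𝕜} {W : ℝ} (hW : 0 < W)
    (h : Tendsto (fun i ↦ ‖F i‖ * W) cofinite (𝓝 0)) : Summable F := by
  refine NonarchimedeanAddGroup.summable_of_tendsto_cofinite_zero ?_
  rw [tendsto_zero_iff_norm_tendsto_zero]
  simpa [mul_assoc, hW.ne'] using h.mul_const W⁻¹

theorem summable_mul (f g : LaurentAlgebra Δ) (n : Fin d → ℤ) :
    Summable fun m ↦ f.coeff m * g.coeff (n - m) := by
  obtain ⟨u, hu⟩ := Δ.nonempty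
  have hinj : Function.Injective fun m : Fin d → ℤ ↦ (m, n - m) :=
    fun _ _ h ↦ congrArg Prod.fst h
  have := (f.tendsto_prod g hu).comp hinj.tendsto_cofinite
  refine summable_of_weight (weight_pos u n) (this.congr fun m ↦ ?_)
  simp

/-- Multiplication of Laurent series: the coefficient of `xⁿ` in `f g` is the convergent sum
`∑ₘ fₘ gₙ₋ₘ`. -/
noncomputable instance : Mul (LaurentAlgebra Δ) where
  mul f g := mk (fun n ↦ ∑' m, f.coeff m * g.coeff (n - m)) <| by
    intro u hu
    rw [Metric.tendsto_nhds]
    intro ε hε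
    have hS := (f.tendsto_prod g hu).eventually (gt_mem_nhds (half_pos hε))
    rw [Filter.eventually_cofinite] at hS
    refine (hS.image fun p ↦ p.1 + p.2).subset fun n hn ↦ ?_
    by_contra hn'
    apply hn
    change dist (‖∑' m, f.coeff m * g.coeff (n - m)‖ * weight u n) 0 < ε
    have hw := weight_pos u n
    have hle : ‖∑' m, f.coeff m * g.coeff (n - m)‖ ≤ ε / 2 / weight u n := by
      refine IsUltrametricDist.norm_tsum_le_of_forall_le fun m ↦ ?_
      rw [le_div_iff₀ hw]
      by_contra hm
      refine hn' ⟨(m, n - m), ?_, by simp⟩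
      simpa using (not_le.1 hm).le
    rw [le_div_iff₀ hw] at hle
    rw [dist_zero_right, Real.norm_of_nonneg (by positivity)]
    linarith

theorem coeff_mul (f g : LaurentAlgebra Δ) (n : Fin d → ℤ) :
    (f * g).coeff n = ∑' m, f.coeff m * g.coeff (n - m) := rfl

/-- The unit is the constant series `1 = x⁰`. -/
noncomputable instance : One (LaurentAlgebra Δ) where
  one := mk (Pi.single 0 1) fun u _ ↦ by
    refine tendsto_nhds_of_eventually_eq ((Set.finite_singleton 0).subset fun n hn ↦ ?_)
    by_contra h
    exact hn (by simp [Pi.single_eq_of_ne (show n ≠ 0 from h)])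

theorem coeff_one (n : Fin d → ℤ) :
    (1 : LaurentAlgebra Δ).coeff n = (Pi.single 0 1 : (Fin d → ℤ) → 𝕜) n := rfl

theorem mul_comm' (f g : LaurentAlgebra Δ) : f * g = g * f := by
  ext n
  rw [coeff_mul, coeff_mul, ← (Equiv.subLeft n).tsum_eq]
  exact tsum_congr fun m ↦ by simp [mul_comm]

theorem one_mul' (f : LaurentAlgebra Δ) : 1 * f = f := by
  ext n
  rw [coeff_mul, tsum_eq_single 0]
  · simp [coeff_one]
  · intro m hm
    simp [coeff_one, Pi.single_eq_of_ne hm]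

theorem add_mul' (f g h : LaurentAlgebra Δ) : (f + g) * h = f * h + g * h := by
  ext n
  simp only [coeff_mul, coeff_add, add_mul]
  exact (f.summable_mul h n).tsum_add (g.summable_mul h n)

theorem smul_mul' (c : 𝕜) (f g : LaurentAlgebra Δ) : (c • f) * g = c • (f * g) := by
  ext n
  simp only [coeff_mul, coeff_smul, mul_assoc]
  exact tsum_mul_left

theorem mul_assoc' (f g h : LaurentAlgebra Δ) : f * g * h = f * (g * h) := by
  ext n
  have hL : (f * g * h).coeff n =
      ∑' m, ∑' l, f.coeff l * g.coeff (m - l) * h.coeff (n - m) := by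
    rw [coeff_mul]
    exact tsum_congr fun m ↦ by rw [coeff_mul, tsum_mul_right]
  have hR : (f * (g * h)).coeff n =
      ∑' l, ∑' m, f.coeff l * g.coeff (m - l) * h.coeff (n - m) := by
    rw [coeff_mul]
    refine tsum_congr fun l ↦ ?_
    rw [coeff_mul, ← tsum_mul_left, ← (Equiv.subRight l).tsum_eq]
    exact tsum_congr fun m ↦ by simp [mul_assoc]
  rw [hL, hR]
  refine Summable.tsum_comm ?_
  obtain ⟨u, hu⟩ := Δ.nonempty
  have h3 := tendsto_mul_cofinite_nhds_zero (f.tendsto_prod g hu) (h.tendsto hu)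
  have hinj : Function.Injective
      fun p : (Fin d → ℤ) × (Fin d → ℤ) ↦ ((p.1, p.2 - p.1), n - p.2) := by
    rintro ⟨l, m⟩ ⟨l', m'⟩ hp
    simp only [Prod.mk.injEq] at hp
    obtain ⟨⟨h1, -⟩, h2⟩ := hp
    rw [sub_right_inj] at h2
    rw [h1, h2]
  refine summable_of_weight (weight_pos u n) ((h3.comp hinj.tendsto_cofinite).congr fun p ↦ ?_)
  have hw : weight u n = weight u (p.1 + (p.2 - p.1)) * weight u (n - p.2) := by
    rw [← weight_add]; congr 1; abel
  simp only [Function.comp_apply, Function.uncurry, norm_mul, hw]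
  ring

noncomputable instance : CommRing (LaurentAlgebra Δ) where
  __ := (inferInstance : AddCommGroup (LaurentAlgebra Δ))
  __ := (inferInstance : Mul (LaurentAlgebra Δ))
  __ := (inferInstance : One (LaurentAlgebra Δ))
  mul_assoc := mul_assoc'
  mul_comm := mul_comm'
  one_mul := one_mul'
  mul_one f := by rw [mul_comm', one_mul']
  right_distrib := add_mul'
  left_distrib f g h := by rw [mul_comm', add_mul', mul_comm' g, mul_comm' h]
  zero_mul f := by ext n; simp [coeff_mul]
  mul_zero f := by ext n; simp [coeff_mul]

noncomputable instance : Algebra 𝕜 (LaurentAlgebra Δ) :=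
  Algebra.ofModule smul_mul' fun c f g ↦ by
    rw [mul_comm f, mul_comm f]; exact smul_mul' c g f

/-- The norm satisfies the axioms of a ring norm. -/
noncomputable def ringNorm : RingNorm (LaurentAlgebra Δ) where
  toFun f := ‖f‖
  map_zero' := by simp [norm_def]
  add_le' f g := by
    refine norm_le (add_nonneg f.norm_nonneg' g.norm_nonneg') fun u hu n ↦ ?_
    rw [coeff_add]
    refine (mul_le_mul_of_nonneg_right (norm_add_le _ _) (weight_pos u n).le).trans ?_
    rw [add_mul]
    exact add_le_add (f.le_norm hu n) (g.le_norm hu n)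
  neg' f := by simp [norm_def]
  mul_le' f g := by
    refine norm_le (mul_nonneg f.norm_nonneg' g.norm_nonneg') fun u hu n ↦ ?_
    rw [coeff_mul, ← le_div_iff₀ (weight_pos u n)]
    refine IsUltrametricDist.norm_tsum_le_of_forall_le fun m ↦ ?_
    rw [le_div_iff₀ (weight_pos u n)]
    have hw : weight u n = weight u m * weight u (n - m) := by rw [← weight_add]; simp
    calc ‖f.coeff m * g.coeff (n - m)‖ * weight u n
        = (‖f.coeff m‖ * weight u m) * (‖g.coeff (n - m)‖ * weight u (n - m)) := by
          rw [norm_mul, hw]; ring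
      _ ≤ ‖f‖ * ‖g‖ := mul_le_mul (f.le_norm hu _) (g.le_norm hu _)
          (mul_nonneg (norm_nonneg _) (weight_pos _ _).le) f.norm_nonneg'
  eq_zero_of_map_eq_zero' f hf := by
    obtain ⟨u, hu⟩ := Δ.nonempty
    ext n
    have h1 := f.le_norm hu n
    change ‖f‖ = 0 at hf
    rw [hf] at h1
    have h2 : ‖f.coeff n‖ ≤ 0 := nonpos_of_mul_nonpos_left h1 (weight_pos u n)
    simpa using h2

noncomputable instance : NormedCommRing (LaurentAlgebra Δ) where
  __ := ringNorm.toNormedRing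
  mul_comm := mul_comm

noncomputable instance : NormedAlgebra 𝕜 (LaurentAlgebra Δ) where
  norm_smul_le c f := by
    refine norm_le (mul_nonneg (norm_nonneg _) f.norm_nonneg') fun u hu n ↦ ?_
    rw [coeff_smul, norm_mul, mul_assoc]
    exact mul_le_mul_of_nonneg_left (f.le_norm hu n) (norm_nonneg _)

end LaurentAlgebra
end LaurentAlgebra
end PolyhedralAffinoid

/-! The algebra is topologically generated by finitely many scaled Laurent monomials of norm at most
`1`, chosen so that every monomial `xⁿ` is, up to a scalar, a product of them whose norm is bounded
below by a constant independent of `n`. Given this, expand `f = ∑ fₙ xⁿ` and rewrite each term as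
`fₙ / eₙ` times such a product `eₙ xⁿ`. The coefficients `fₙ / eₙ` tend to `0`, so they define a
Tate series mapping to `f` (`exists_epimorphism_of_monomials`).

The generators come from the inequalities `bᵢ·u ≥ cᵢ`. Some `N > 0` makes every `N cᵢ` the valuation
of an `aᵢ` in the base field, and then `aᵢ⁻¹ x^(N bᵢ)` has norm at most `1` on `Δ`. By linear
programming duality (`exists_nonneg_combination`), `n` is nearly `∑ lᵢ bᵢ` with `lᵢ ≥ 0` and `-∑ lᵢ
cᵢ` at most about `log ‖xⁿ‖`. Rounding each `lᵢ` down to a multiple of `N` leaves a remainder in a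
finite box, and one scaled monomial is added for each point of that box. All errors are bounded
uniformly in `n`. -/

namespace PolyhedralAffinoid

/-! ### Linear programming duality -/

/-- Approximate linear programming duality: a bound `t` for the linear form `-n` on a nonempty
bounded polyhedron is witnessed, up to bounded error, by a nonnegative combination of the
defining inequalities. -/
theorem exists_nonneg_combination {d r : ℕ} (b : Fin r → Fin d → ℝ) (c : Fin r → ℝ)
    (hne : {u : Fin d → ℝ | ∀ i, c i ≤ ∑ j, b i j * u j}.Nonempty)
    (hb : Bornology.IsBounded {u : Fin d → ℝ | ∀ i, c i ≤ ∑ j, b i j * u j})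
    (n : Fin d → ℝ) (t : ℝ)
    (hn : ∀ u : Fin d → ℝ, (∀ i, c i ≤ ∑ j, b i j * u j) → -∑ j, n j * u j ≤ t) :
    ∃ l : Fin r → ℝ, (∀ i, 0 ≤ l i) ∧ (∀ j, |n j - ∑ i, l i * b i j| ≤ 1) ∧
      -∑ i, l i * c i ≤ t + 1 := by
  -- The convex cone of all consequences of the inequalities. Separation only places `(n, t)` in its
  -- closure; this costs a bounded error but avoids proving the cone closed.
  set S : Set ((Fin d → ℝ) × ℝ) :=
    {p | ∃ l : Fin r → ℝ, (∀ i, 0 ≤ l i) ∧ (∀ j, p.1 j = ∑ i, l i * b i j) ∧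
      -∑ i, l i * c i ≤ p.2}
  have hconv : Convex ℝ S := by
    rintro p ⟨l, hl, hp1, hp2⟩ q ⟨m, hm, hq1, hq2⟩ α β hα hβ -
    refine ⟨fun i ↦ α * l i + β * m i, fun i ↦ ?_, fun j ↦ ?_, ?_⟩
    · have := hl i; have := hm i; positivity
    · simp only [Prod.fst_add, Prod.smul_fst, Pi.add_apply, Pi.smul_apply, smul_eq_mul, hp1, hq1,
        add_mul, Finset.sum_add_distrib, Finset.mul_sum, mul_assoc]
    · simp only [Prod.snd_add, Prod.smul_snd, smul_eq_mul, add_mul, Finset.sum_add_distrib,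
        mul_assoc, ← Finset.mul_sum]
      have := mul_le_mul_of_nonneg_left hp2 hα
      have := mul_le_mul_of_nonneg_left hq2 hβ
      linarith
  have hcone : ∀ p ∈ S, ∀ k : ℝ, 0 ≤ k → k • p ∈ S := by
    rintro p ⟨l, hl, hp1, hp2⟩ k hk
    refine ⟨fun i ↦ k * l i, fun i ↦ mul_nonneg hk (hl i), fun j ↦ ?_, ?_⟩
    · simp only [Prod.smul_fst, Pi.smul_apply, smul_eq_mul, hp1, Finset.mul_sum, mul_assoc]
    · simp only [Prod.smul_snd, smul_eq_mul, mul_assoc, ← Finset.mul_sum]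
      have := mul_le_mul_of_nonneg_left hp2 hk
      linarith
  have h0 : (0 : (Fin d → ℝ) × ℝ) ∈ S := ⟨0, by simp, by simp, by simp⟩
  have hmem : (n, t) ∈ closure S := by
    by_contra hnot
    obtain ⟨f, a, hfa, haf⟩ :=
      geometric_hahn_banach_point_closed hconv.closure isClosed_closure hnot
    have ha : a < 0 := by simpa using haf 0 (subset_closure h0)
    -- A functional bounded below on a cone is nonnegative there: otherwise a rescaled point takes
    -- the value `a` exactly.
    have hpos : ∀ p ∈ S, 0 ≤ f p := by
      intro p hp
      by_contra! hneg
      have := haf _ (subset_closure (hcone p hp (a / f p) (div_nonneg_of_nonpos ha.le hneg.le)))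
      rw [map_smul, smul_eq_mul, div_mul_cancel₀ _ hneg.ne] at this
      exact lt_irrefl _ this
    set w : Fin d → ℝ := fun j ↦ f (Pi.single j 1, 0) with hw
    set τ : ℝ := f (0, 1) with hτ
    have hf : ∀ x s, f (x, s) = (∑ j, x j * w j) + s * τ := by
      intro x s
      have h1 : (x, s) = (∑ j, x j • ((Pi.single j 1 : Fin d → ℝ), (0 : ℝ))) + s • (0, 1) := by
        ext k
        · simp [Prod.fst_sum, Finset.sum_apply, Pi.single_apply]
        · simp [Prod.snd_sum]
      rw [h1]
      simp [map_add, map_sum, map_smul, hw, hτ, -Prod.smul_mk]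
    have hgen : ∀ i, 0 ≤ (∑ j, b i j * w j) - c i * τ := by
      intro i
      have := hpos (b i, -c i) ⟨Pi.single i 1, fun k ↦ ?_, fun j ↦ ?_, ?_⟩
      · rw [hf] at this; linarith
      · by_cases h : k = i
        · subst h; simp
        · simp [Pi.single_eq_of_ne h]
      · simp [Pi.single_apply]
      · simp [Pi.single_apply]
    have hτ0 : 0 ≤ τ := hpos (0, 1) ⟨0, by simp, by simp, by simp⟩
    have hlt : (∑ j, n j * w j) + t * τ < 0 := by rw [← hf]; exact hfa.trans ha
    -- If `τ = 0`, then `w` is a nonzero recession direction, contradicting boundedness. If `τ > 0`,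
    -- then `w / τ` lies in the polyhedron and violates `hn`.
    rcases hτ0.eq_or_lt with h | h
    · rw [← h] at hlt
      simp only [← h, mul_zero, sub_zero, add_zero] at hgen hlt
      obtain ⟨u, hu⟩ := hne
      obtain ⟨B, hB⟩ := hb.exists_norm_le
      obtain ⟨j, hj⟩ : ∃ j, w j ≠ 0 := by
        by_contra! h
        simp [h] at hlt
      have hk : ∀ k : ℝ, 0 ≤ k → |u j + k * w j| ≤ B := by
        intro k hk
        have hmem := hB (u + k • w) fun i ↦ by
          simp only [Pi.add_apply, Pi.smul_apply, smul_eq_mul, mul_add, Finset.sum_add_distrib,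
            mul_left_comm _ k, ← Finset.mul_sum]
          have := hu i
          have := mul_nonneg hk (hgen i)
          linarith
        exact (norm_le_pi_norm (u + k • w) j).trans hmem
      have hB0 : 0 ≤ B := (abs_nonneg _).trans (hk 0 le_rfl)
      have hw0 : 0 < |w j| := abs_pos.2 hj
      have h1 := hk ((B + |u j| + 1) / |w j|) (by positivity)
      have h2 : |(B + |u j| + 1) / |w j| * w j| = B + |u j| + 1 := by
        rw [abs_mul, abs_of_nonneg (by positivity), div_mul_cancel₀ _ hw0.ne']
      have h3 := abs_sub_abs_le_abs_sub ((B + |u j| + 1) / |w j| * w j) (-u j)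
      rw [sub_neg_eq_add, abs_neg, add_comm _ (u j), h2] at h3
      linarith
    · have := hn (fun j ↦ w j / τ) fun i ↦ by
        simp only [← mul_div_assoc, ← Finset.sum_div]
        rw [le_div_iff₀ h]
        linarith [hgen i]
      simp only [← mul_div_assoc, ← Finset.sum_div] at this
      rw [← neg_div, div_le_iff₀ h] at this
      linarith
  obtain ⟨p, ⟨l, hl, hp1, hp2⟩, hp⟩ := Metric.mem_closure_iff.1 hmem 1 one_pos
  rw [Prod.dist_eq, max_lt_iff] at hp
  refine ⟨l, hl, fun j ↦ ?_, ?_⟩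
  · rw [← hp1, ← Real.dist_eq]
    exact (dist_le_pi_dist n p.1 j).trans hp.1.le
  · have := (abs_lt.1 (Real.dist_eq t p.2 ▸ hp.2)).1
    linarith

/-! ### The value group modulo that of the base field -/

/-- Elements of the value group are torsion modulo the value group of `𝕜`. -/
theorem exists_nsmul_eq_neg_log_norm {𝕜 : Type*} [NontriviallyNormedField 𝕜] [CompleteSpace 𝕜]
    [IsUltrametricDist 𝕜] {γ : ℝ} (hγ : γ ∈ valueGroup 𝕜) :
    ∃ N : ℕ, 0 < N ∧ ∃ a : 𝕜, a ≠ 0 ∧ N * γ = -Real.log ‖a‖ := by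
  obtain ⟨x, hx, rfl⟩ := hγ
  have hint : IsIntegral 𝕜 x := Algebra.IsIntegral.isIntegral x
  have hdeg := minpoly.natDegree_pos hint
  have ha : (minpoly 𝕜 x).coeff 0 ≠ 0 := minpoly.coeff_zero_ne_zero hint hx
  -- `N` is the degree of the minimal polynomial and `a` its constant term: the spectral norm of `x`
  -- is `‖a‖ ^ (1 / N)`.
  refine ⟨_, hdeg, _, ha, ?_⟩
  rw [spectralNorm.spectralNorm_eq_norm_coeff_zero_rpow, Real.log_rpow (norm_pos_iff.2 ha)]
  have : ((minpoly 𝕜 x).natDegree : ℝ) ≠ 0 := by exact_mod_cast hdeg.ne'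
  field_simp

theorem exists_common_nsmul_eq_neg_log_norm {𝕜 : Type*} [NontriviallyNormedField 𝕜]
    [CompleteSpace 𝕜] [IsUltrametricDist 𝕜] {r : ℕ} {c : Fin r → ℝ}
    (hc : ∀ i, c i ∈ valueGroup 𝕜) :
    ∃ N : ℕ, 0 < N ∧ ∃ a : Fin r → 𝕜, ∀ i, a i ≠ 0 ∧ N * c i = -Real.log ‖a i‖ := by
  choose N hN a ha h using fun i ↦ exists_nsmul_eq_neg_log_norm (hc i)
  refine ⟨∏ i, N i, Finset.prod_pos fun i _ ↦ hN i,
    fun i ↦ a i ^ (∏ k ∈ Finset.univ.erase i, N k), fun i ↦ ⟨pow_ne_zero _ (ha i), ?_⟩⟩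
  rw [norm_pow, Real.log_pow, ← mul_neg, ← h i,
    ← Finset.mul_prod_erase _ _ (Finset.mem_univ i)]
  push_cast
  ring

end PolyhedralAffinoid

/-! ### Evaluation of Tate series in an ultrametric Banach algebra -/

namespace PolyhedralAffinoid

namespace TateAlgebra

variable {𝕜 : Type*} [NontriviallyNormedField 𝕜] [IsUltrametricDist 𝕜]
  {A : Type*} [NormedCommRing A] [NormedAlgebra 𝕜 A] [CompleteSpace A] [IsUltrametricDist A]
  [NormOneClass A] {m : ℕ} {h : Fin m → A}

theorem norm_coeff_le (F : TateAlgebra 𝕜 m) (k : Fin m →₀ ℕ) :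
    ‖MvPowerSeries.coeff k F.1‖ ≤ ‖F‖ := by
  rw [norm_def]
  exact le_ciSup (tendsto F).bddAbove_range_of_cofinite k

omit [CompleteSpace A] [IsUltrametricDist A] in
theorem norm_coeff_smul_prod_le (hh : ∀ i, ‖h i‖ ≤ 1) (F : TateAlgebra 𝕜 m) (k : Fin m →₀ ℕ) :
    ‖MvPowerSeries.coeff k F.1 • ∏ i, h i ^ k i‖ ≤ ‖MvPowerSeries.coeff k F.1‖ := by
  refine (norm_smul_le _ _).trans (mul_le_of_le_one_right (norm_nonneg _) ?_)
  refine (Finset.norm_prod_le _ _).trans (Finset.prod_le_one (fun _ _ ↦ norm_nonneg _) ?_)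
  exact fun i _ ↦ (norm_pow_le _ _).trans (pow_le_one₀ (norm_nonneg _) (hh i))

theorem summable_coeff_smul_prod (hh : ∀ i, ‖h i‖ ≤ 1) (F : TateAlgebra 𝕜 m) :
    Summable fun k : Fin m →₀ ℕ ↦ MvPowerSeries.coeff k F.1 • ∏ i, h i ^ k i := by
  refine NonarchimedeanAddGroup.summable_of_tendsto_cofinite_zero ?_
  exact squeeze_zero_norm (norm_coeff_smul_prod_le hh F) (tendsto F)

omit [NormedCommRing A] [NormedAlgebra 𝕜 A] [CompleteSpace A] [IsUltrametricDist A]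
  [NormOneClass A] in
theorem coeff_mul (F G : TateAlgebra 𝕜 m) (k : Fin m →₀ ℕ) :
    MvPowerSeries.coeff k (F * G).1 = ∑ p ∈ Finset.HasAntidiagonal.antidiagonal k,
      MvPowerSeries.coeff p.1 F.1 * MvPowerSeries.coeff p.2 G.1 := by
  classical
  exact MvPowerSeries.coeff_mul k F.1 G.1

/-- The linear map underlying `TateAlgebra.eval`. -/
noncomputable def evalLinear (h : Fin m → A) (hh : ∀ i, ‖h i‖ ≤ 1) : TateAlgebra 𝕜 m →ₗ[𝕜] A where
  toFun F := ∑' k : Fin m →₀ ℕ, MvPowerSeries.coeff k F.1 • ∏ i, h i ^ k i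
  map_add' F G := by
    rw [← (summable_coeff_smul_prod hh F).tsum_add (summable_coeff_smul_prod hh G)]
    exact tsum_congr fun k ↦ by rw [← add_smul]; rfl
  map_smul' c F := by
    rw [RingHom.id_apply, ← (summable_coeff_smul_prod hh F).tsum_const_smul]
    exact tsum_congr fun k ↦ by rw [← smul_assoc]; rfl

theorem evalLinear_apply (hh : ∀ i, ‖h i‖ ≤ 1) (F : TateAlgebra 𝕜 m) :
    evalLinear h hh F = ∑' k : Fin m →₀ ℕ, MvPowerSeries.coeff k F.1 • ∏ i, h i ^ k i := rfl

theorem evalLinear_one (hh : ∀ i, ‖h i‖ ≤ 1) : evalLinear (𝕜 := 𝕜) h hh 1 = 1 := by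
  classical
  rw [evalLinear_apply, tsum_eq_single 0]
  · simp
  · intro k hk
    rw [OneMemClass.coe_one, MvPowerSeries.coeff_one, if_neg hk, zero_smul]

omit [CompleteSpace A] [IsUltrametricDist A] [NormOneClass A] in
theorem coeff_mul_smul_prod (F G : TateAlgebra 𝕜 m) (k : Fin m →₀ ℕ) :
    MvPowerSeries.coeff k (F * G).1 • ∏ i, h i ^ k i =
      ∑ p ∈ Finset.HasAntidiagonal.antidiagonal k,
        (MvPowerSeries.coeff p.1 F.1 • ∏ i, h i ^ p.1 i) *
          (MvPowerSeries.coeff p.2 G.1 • ∏ i, h i ^ p.2 i) := by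
  rw [coeff_mul, Finset.sum_smul]
  refine Finset.sum_congr rfl fun p hp ↦ ?_
  obtain rfl := Finset.HasAntidiagonal.mem_antidiagonal.1 hp
  have hprod : ∏ i, h i ^ (p.1 + p.2) i = (∏ i, h i ^ p.1 i) * ∏ i, h i ^ p.2 i := by
    simp only [Finsupp.add_apply, pow_add, Finset.prod_mul_distrib]
  rw [hprod, smul_mul_smul_comm]

/-- Over a nonarchimedean ring the products of two summable families are summable over pairs, so the
double sum may be regrouped along antidiagonals. -/
theorem evalLinear_mul (hh : ∀ i, ‖h i‖ ≤ 1) (F G : TateAlgebra 𝕜 m) :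
    evalLinear h hh (F * G) = evalLinear h hh F * evalLinear h hh G := by
  have : NonarchimedeanRing A :=
    { is_nonarchimedean := NonarchimedeanAddGroup.is_nonarchimedean }
  have hF := summable_coeff_smul_prod hh F
  have hG := summable_coeff_smul_prod hh G
  have hFG := hF.mul_of_nonarchimedean hG
  exact (tsum_congr fun k ↦ coeff_mul_smul_prod F G k).trans
    (hF.tsum_mul_tsum_eq_tsum_sum_antidiagonal hG hFG).symm

/-- Evaluation of the series of the Tate algebra at elements of norm at most `1` of a Banach
algebra. -/
noncomputable def eval (h : Fin m → A) (hh : ∀ i, ‖h i‖ ≤ 1) : TateAlgebra 𝕜 m →ₐ[𝕜] A :=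
  AlgHom.ofLinearMap (evalLinear h hh) (evalLinear_one hh) (evalLinear_mul hh)

theorem eval_apply (hh : ∀ i, ‖h i‖ ≤ 1) (F : TateAlgebra 𝕜 m) :
    eval h hh F = ∑' k : Fin m →₀ ℕ, MvPowerSeries.coeff k F.1 • ∏ i, h i ^ k i := rfl

theorem continuous_eval (hh : ∀ i, ‖h i‖ ≤ 1) : Continuous (eval (𝕜 := 𝕜) h hh) := by
  refine AddMonoidHomClass.continuous_of_bound (eval (𝕜 := 𝕜) h hh) 1 fun F ↦ ?_
  rw [one_mul, eval_apply]
  exact IsUltrametricDist.norm_tsum_le_of_forall_le fun k ↦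
    (norm_coeff_smul_prod_le hh F k).trans (norm_coeff_le F k)

/-- The preimage is the power series with coefficient `c n` at `k n` and `0` elsewhere. Injectivity
of `k` keeps these coefficients from colliding. -/
theorem mem_range_eval (hh : ∀ i, ‖h i‖ ≤ 1) {ι : Type*} {k : ι → Fin m →₀ ℕ}
    (hk : Function.Injective k) {c : ι → 𝕜} (hc : Tendsto (fun n ↦ ‖c n‖) cofinite (𝓝 0)) :
    ∑' n, c n • ∏ i, h i ^ k n i ∈ Set.range (eval (𝕜 := 𝕜) h hh) := by
  set G : MvPowerSeries (Fin m) 𝕜 := fun l ↦ Function.extend k c 0 l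
  have hGk : ∀ n, MvPowerSeries.coeff (k n) G = c n := fun n ↦ by
    rw [MvPowerSeries.coeff_apply]
    exact hk.extend_apply c 0 n
  have hG0 : ∀ l, l ∉ Set.range k → MvPowerSeries.coeff l G = 0 := fun l hl ↦ by
    rw [MvPowerSeries.coeff_apply]
    exact Function.extend_apply' c (0 : (Fin m →₀ ℕ) → 𝕜) l hl
  have hGlim : Tendsto (fun l ↦ ‖MvPowerSeries.coeff l G‖) cofinite (𝓝 0) := by
    rw [Metric.tendsto_nhds] at hc ⊢
    intro ε hε
    have hfin := hc ε hε
    rw [Filter.eventually_cofinite] at hfin ⊢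
    refine (hfin.image k).subset fun l hl ↦ ?_
    by_cases hr : l ∈ Set.range k
    · obtain ⟨n, rfl⟩ := hr
      refine ⟨n, fun hlt ↦ hl ?_, rfl⟩
      rwa [hGk]
    · refine absurd ?_ hl
      rw [hG0 l hr]
      simpa using hε
  have hmem : G ∈ TateAlgebra 𝕜 m := by
    change MvPowerSeries.IsRestricted (fun _ ↦ (1 : ℝ)) G
    simpa [MvPowerSeries.IsRestricted, Finsupp.prod] using hGlim
  refine ⟨⟨G, hmem⟩, ?_⟩
  rw [eval_apply, ← hk.tsum_eq]
  · exact tsum_congr fun n ↦ by rw [hGk]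
  · intro l hl
    by_contra hr
    refine hl ?_
    beta_reduce
    rw [hG0 l hr, zero_smul]

end TateAlgebra
end PolyhedralAffinoid

/-! ### Completeness and monomial expansions of Laurent series -/

namespace PolyhedralAffinoid
namespace LaurentAlgebra

variable {𝕜 : Type*} [NontriviallyNormedField 𝕜] [IsUltrametricDist 𝕜] {d : ℕ}
  {Δ : BoundedRationalPolyhedron 𝕜 d} [CompleteSpace 𝕜]

instance : IsUltrametricDist (LaurentAlgebra Δ) := by
  refine IsUltrametricDist.isUltrametricDist_of_isNonarchimedean_norm fun f g ↦ ?_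
  refine norm_le (le_max_of_le_left f.norm_nonneg') fun u hu n ↦ ?_
  rw [coeff_add]
  refine (mul_le_mul_of_nonneg_right (IsUltrametricDist.norm_add_le_max _ _)
    (weight_pos u n).le).trans ?_
  rw [max_mul_of_nonneg _ _ (weight_pos u n).le]
  exact max_le_max (f.le_norm hu n) (g.le_norm hu n)

theorem coeff_sub (f g : LaurentAlgebra Δ) (n : Fin d → ℤ) :
    (f - g).coeff n = f.coeff n - g.coeff n := rfl

/-- The coefficient of `xⁿ` as an additive map. -/
def coeffHom (n : Fin d → ℤ) : LaurentAlgebra Δ →+ 𝕜 where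
  toFun f := f.coeff n
  map_zero' := rfl
  map_add' _ _ := rfl

omit [CompleteSpace 𝕜] in
theorem norm_coeff_le (f : LaurentAlgebra Δ) {u : Fin d → ℝ} (hu : u ∈ Δ.carrier)
    (n : Fin d → ℤ) : ‖f.coeff n‖ ≤ (weight u n)⁻¹ * ‖f‖ := by
  rw [le_inv_mul_iff₀ (weight_pos u n), mul_comm]
  exact f.le_norm hu n

theorem continuous_coeffHom (n : Fin d → ℤ) :
    Continuous (coeffHom n : LaurentAlgebra Δ →+ 𝕜) := by
  obtain ⟨u, hu⟩ := Δ.nonempty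
  exact AddMonoidHomClass.continuous_of_bound _ _ fun f ↦ norm_coeff_le f hu n

/-- Limits are taken coefficientwise. The Cauchy estimate is uniform in `u` and `n`, so it survives
the limit and gives both the decay of the limit coefficients and convergence in norm. -/
instance : CompleteSpace (LaurentAlgebra Δ) := by
  refine Metric.complete_of_cauchySeq_tendsto fun F hF ↦ ?_
  have hlim : ∀ n, ∃ a, Tendsto (fun k ↦ (F k).coeff n) atTop (𝓝 a) := fun n ↦
    cauchySeq_tendsto_of_complete
      (hF.map (uniformContinuous_addMonoidHom_of_continuous (continuous_coeffHom n)))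
  choose a ha using hlim
  have hclose : ∀ ε > 0, ∃ K, ∀ k ≥ K, ∀ u ∈ Δ.carrier, ∀ n,
      ‖(F k).coeff n - a n‖ * weight u n ≤ ε := by
    intro ε hε
    obtain ⟨K, hK⟩ := Metric.cauchySeq_iff.1 hF ε hε
    refine ⟨K, fun k hk u hu n ↦ ?_⟩
    refine le_of_tendsto (((tendsto_const_nhds.sub (ha n)).norm).mul_const (weight u n))
      (eventually_atTop.2 ⟨K, fun l hl ↦ ?_⟩)
    rw [← coeff_sub]
    exact (le_norm _ hu n).trans
      ((dist_eq_norm (F k) (F l)).symm.le.trans (hK k hk l hl).le)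
  refine ⟨mk a fun u hu ↦ ?_, ?_⟩
  · rw [Metric.tendsto_nhds]
    intro ε hε
    obtain ⟨K, hK⟩ := hclose (ε / 2) (half_pos hε)
    filter_upwards [((F K).tendsto hu).eventually (gt_mem_nhds (half_pos hε))] with n hn
    have hw := (weight_pos u n).le
    rw [dist_zero_right, Real.norm_of_nonneg (mul_nonneg (norm_nonneg _) hw)]
    calc ‖a n‖ * weight u n
        ≤ (‖(F K).coeff n‖ + ‖(F K).coeff n - a n‖) * weight u n := by
          refine mul_le_mul_of_nonneg_right ?_ hw
          exact norm_le_norm_add_norm_sub (F K |>.coeff n) (a n)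
      _ < ε := by
          have := hK K le_rfl u hu n
          rw [add_mul]
          linarith
  · rw [Metric.tendsto_atTop]
    intro ε hε
    obtain ⟨K, hK⟩ := hclose (ε / 2) (half_pos hε)
    refine ⟨K, fun k hk ↦ ?_⟩
    rw [dist_eq_norm]
    refine (norm_le (half_pos hε).le fun u hu n ↦ ?_).trans_lt (half_lt_self hε)
    exact hK k hk u hu n

/-- The monomial `a xⁿ`. -/
def single (n : Fin d → ℤ) (a : 𝕜) : LaurentAlgebra Δ :=
  mk (Pi.single n a) fun u _ ↦ by
    refine tendsto_nhds_of_eventually_eq ((Set.finite_singleton n).subset fun m hm ↦ ?_)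
    by_contra h
    exact hm (by simp [Pi.single_eq_of_ne (show m ≠ n from h)])

omit [CompleteSpace 𝕜] in
theorem coeff_single (n m : Fin d → ℤ) (a : 𝕜) :
    (single n a : LaurentAlgebra Δ).coeff m = (Pi.single n a : (Fin d → ℤ) → 𝕜) m := rfl

theorem smul_single (n : Fin d → ℤ) (c a : 𝕜) :
    c • (single n a : LaurentAlgebra Δ) = single n (c * a) := by
  ext m
  by_cases h : m = n
  · subst h; simp [coeff_single]
  · simp [coeff_single, Pi.single_eq_of_ne h]

omit [CompleteSpace 𝕜] in
theorem single_zero_one : (single 0 1 : LaurentAlgebra Δ) = 1 := rfl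

theorem single_mul_single (n m : Fin d → ℤ) (a b : 𝕜) :
    (single n a * single m b : LaurentAlgebra Δ) = single (n + m) (a * b) := by
  ext k
  rw [coeff_mul, tsum_eq_single n]
  · by_cases h : k = n + m
    · subst h; simp [coeff_single]
    · have h' : k - n ≠ m := fun e ↦ h (by rw [← e]; abel)
      simp [coeff_single, Pi.single_eq_of_ne h, Pi.single_eq_of_ne h']
  · intro l hl
    simp [coeff_single, Pi.single_eq_of_ne hl]

theorem single_pow (n : Fin d → ℤ) (a : 𝕜) (k : ℕ) :
    (single n a ^ k : LaurentAlgebra Δ) = single (k • n) (a ^ k) := by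
  induction k with
  | zero => rw [pow_zero, pow_zero, zero_smul, single_zero_one]
  | succ k ih => rw [pow_succ, ih, single_mul_single, pow_succ, succ_nsmul]

theorem prod_single {ι : Type*} (s : Finset ι) (n : ι → Fin d → ℤ) (a : ι → 𝕜) :
    (∏ i ∈ s, single (n i) (a i) : LaurentAlgebra Δ) = single (∑ i ∈ s, n i) (∏ i ∈ s, a i) := by
  classical
  induction s using Finset.induction_on with
  | empty => simp [single_zero_one]
  | insert i s hi ih =>
    rw [Finset.prod_insert hi, ih, single_mul_single, Finset.sum_insert hi, Finset.prod_insert hi]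

instance : NormSMulClass 𝕜 (LaurentAlgebra Δ) :=
  NormedSpace.toNormSMulClass (𝕜 := 𝕜) (E := LaurentAlgebra Δ)

theorem norm_single (n : Fin d → ℤ) (a : 𝕜) :
    ‖(single n a : LaurentAlgebra Δ)‖ = ‖a‖ * ‖(single n 1 : LaurentAlgebra Δ)‖ := by
  rw [← norm_smul, smul_single, mul_one]

omit [CompleteSpace 𝕜] in
theorem le_norm_single {u : Fin d → ℝ} (hu : u ∈ Δ.carrier) (n : Fin d → ℤ) (a : 𝕜) :
    ‖a‖ * weight u n ≤ ‖(single n a : LaurentAlgebra Δ)‖ := by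
  simpa [coeff_single] using le_norm (single n a : LaurentAlgebra Δ) hu n

theorem norm_single_one_pos (n : Fin d → ℤ) : 0 < ‖(single n 1 : LaurentAlgebra Δ)‖ := by
  obtain ⟨u, hu⟩ := Δ.nonempty
  refine lt_of_lt_of_le ?_ (le_norm_single hu n 1)
  rw [norm_one, one_mul]
  exact weight_pos u n

omit [CompleteSpace 𝕜] in
theorem norm_single_le {n : Fin d → ℤ} {a : 𝕜} {C : ℝ} (hC : 0 ≤ C)
    (h : ∀ u ∈ Δ.carrier, ‖a‖ * weight u n ≤ C) : ‖(single n a : LaurentAlgebra Δ)‖ ≤ C := by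
  refine norm_le hC fun u hu m ↦ ?_
  rw [coeff_single]
  by_cases hm : m = n
  · subst hm; simpa using h u hu
  · simpa [Pi.single_eq_of_ne hm] using hC

instance : @NormOneClass (LaurentAlgebra Δ) NormedCommRing.toNormedRing.toNorm
    NormedCommRing.toNormedRing.toRing.toOne where
  norm_one := by
    refine le_antisymm ?_ ?_
    · exact norm_single_le zero_le_one fun u _ ↦ by rw [weight_zero, norm_one, mul_one]
    · obtain ⟨u, hu⟩ := Δ.nonempty
      have := le_norm_single (Δ := Δ) hu 0 (1 : 𝕜)
      rw [weight_zero, norm_one, mul_one] at this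
      exact this

/-- Decay is assumed only for each `u` separately. It becomes uniform on `Δ` because each weight is
maximized at one of finitely many vertices, so a finite sum of null families dominates. -/
theorem tendsto_norm_single_coeff (f : LaurentAlgebra Δ) :
    Tendsto (fun n ↦ ‖(single n (f.coeff n) : LaurentAlgebra Δ)‖) cofinite (𝓝 0) := by
  obtain ⟨r, b, c, -, hΔ⟩ := Δ.rational
  obtain ⟨V, hV, hVΔ, hmin⟩ := exists_vertices (fun i j ↦ (b i j : ℝ)) c (hΔ ▸ Δ.bounded)
  have hlim : Tendsto (fun n ↦ ∑ v ∈ hV.toFinset, ‖f.coeff n‖ * weight v n) cofinite (𝓝 0) := by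
    rw [← Finset.sum_const_zero (s := hV.toFinset)]
    exact tendsto_finsetSum _ fun v hv ↦ f.tendsto (hΔ ▸ hVΔ (hV.mem_toFinset.1 hv))
  have hnn : ∀ v n, 0 ≤ ‖f.coeff n‖ * weight v n := fun v n ↦
    mul_nonneg (norm_nonneg _) (weight_pos v n).le
  refine squeeze_zero (fun _ ↦ norm_nonneg _) (fun n ↦ ?_) hlim
  refine norm_single_le (Finset.sum_nonneg fun v _ ↦ hnn v n) fun u hu ↦ ?_
  obtain ⟨v, hv, hle⟩ := hmin (fun j ↦ (n j : ℝ)) u (by rw [hΔ] at hu; exact hu)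
  calc ‖f.coeff n‖ * weight u n ≤ ‖f.coeff n‖ * weight v n :=
        mul_le_mul_of_nonneg_left (Real.exp_le_exp.2 (neg_le_neg hle)) (norm_nonneg _)
    _ ≤ _ := Finset.single_le_sum (fun v _ ↦ hnn v n) (hV.mem_toFinset.2 hv)

theorem tsum_single_coeff (f : LaurentAlgebra Δ) :
    ∑' n, (single n (f.coeff n) : LaurentAlgebra Δ) = f := by
  have hs : Summable fun n ↦ (single n (f.coeff n) : LaurentAlgebra Δ) :=
    NonarchimedeanAddGroup.summable_of_tendsto_cofinite_zero
      (tendsto_zero_iff_norm_tendsto_zero.2 (tendsto_norm_single_coeff f))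
  ext m
  have h := hs.map_tsum (coeffHom m) (continuous_coeffHom m)
  change (∑' n, (single n (f.coeff n) : LaurentAlgebra Δ)).coeff m = _ at h
  rw [h, tsum_eq_single m]
  · change (single m (f.coeff m) : LaurentAlgebra Δ).coeff m = _
    simp [coeff_single]
  · intro n hn
    change (single n (f.coeff n) : LaurentAlgebra Δ).coeff m = 0
    simp [coeff_single, Pi.single_eq_of_ne hn.symm]

/-- If every Laurent monomial is, up to a scalar, a product of the `h i`, with norm bounded
below, then the `h i` define a continuous epimorphism from a Tate algebra. -/
theorem exists_epimorphism_of_monomials {ι : Type*} [Fintype ι] (h : ι → LaurentAlgebra Δ)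
    (hh : ∀ i, ‖h i‖ ≤ 1) (C : ℝ)
    (hgen : ∀ n, ∃ (k : ι → ℕ) (e : 𝕜), ∏ i, h i ^ k i = single n e ∧
      1 ≤ C * ‖(single n e : LaurentAlgebra Δ)‖) :
    ∃ (m : ℕ) (φ : TateAlgebra 𝕜 m →ₐ[𝕜] LaurentAlgebra Δ),
      Continuous φ ∧ Function.Surjective φ := by
  set σ := (Fintype.equivFin ι).symm
  choose k₀ e he hC using hgen
  have he0 : ∀ n, e n ≠ 0 := fun n h0 ↦ by
    have := hC n
    rw [norm_single, h0] at this
    norm_num at this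
  set k : (Fin d → ℤ) → (Fin (Fintype.card ι) →₀ ℕ) :=
    fun n ↦ Finsupp.equivFunOnFinite.symm (k₀ n ∘ σ)
  have hkprod : ∀ n, ∏ i, h (σ i) ^ k n i = single n (e n) := fun n ↦ by
    rw [← he n]
    exact σ.prod_comp fun i ↦ h i ^ k₀ n i
  -- The product with exponents `k n` is a nonzero multiple of `xⁿ`, hence determines `n`.
  have hinj : Function.Injective k := by
    intro n n' hnn
    have h1 := hkprod n
    rw [hnn, hkprod] at h1
    have h2 := congrArg (fun F : LaurentAlgebra Δ ↦ F.coeff n) h1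
    by_contra hne
    simp only [coeff_single, Pi.single_eq_of_ne hne, Pi.single_eq_same] at h2
    exact he0 n h2.symm
  refine ⟨_, TateAlgebra.eval (fun i ↦ h (σ i)) fun i ↦ hh (σ i), TateAlgebra.continuous_eval _,
    fun f ↦ ?_⟩
  -- The uniform lower bound on `‖eₙ xⁿ‖` enters here: dividing by `eₙ` costs at most the factor
  -- `C`.
  have hbound : ∀ n, ‖f.coeff n / e n‖ ≤ C * ‖(single n (f.coeff n) : LaurentAlgebra Δ)‖ := by
    intro n
    have h1 : ‖(single n (f.coeff n) : LaurentAlgebra Δ)‖ =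
        ‖f.coeff n / e n‖ * ‖(single n (e n) : LaurentAlgebra Δ)‖ := by
      rw [← norm_smul, smul_single, div_mul_cancel₀ _ (he0 n)]
    rw [h1, mul_left_comm]
    exact le_mul_of_one_le_right (norm_nonneg _) (hC n)
  have hlim : Tendsto (fun n ↦ ‖f.coeff n / e n‖) cofinite (𝓝 0) :=
    squeeze_zero (fun _ ↦ norm_nonneg _) hbound
      (by simpa using (tendsto_norm_single_coeff f).const_mul C)
  have hsum : ∑' n, (f.coeff n / e n) • ∏ i, h (σ i) ^ k n i = f := by
    rw [← tsum_single_coeff f]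
    refine tsum_congr fun n ↦ ?_
    -- The first rewrite undoes the expansion of `f` inside its own coefficients on the left.
    rw [tsum_single_coeff, hkprod, smul_single, div_mul_cancel₀ _ (he0 n)]
  have := TateAlgebra.mem_range_eval (h := fun i ↦ h (σ i)) (fun i ↦ hh (σ i)) hinj hlim
  exact hsum ▸ this

end LaurentAlgebra
end PolyhedralAffinoid

/-! ### The finite generating family of monomials -/

namespace PolyhedralAffinoid
namespace LaurentAlgebra

variable {𝕜 : Type*} [NontriviallyNormedField 𝕜] [IsUltrametricDist 𝕜] {d : ℕ}
  {Δ : BoundedRationalPolyhedron 𝕜 d} [CompleteSpace 𝕜]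

theorem norm_algebraMap_eq (a : 𝕜) : ‖algebraMap 𝕜 (LaurentAlgebra Δ) a‖ = ‖a‖ :=
  norm_algebraMap' (LaurentAlgebra Δ) a

/-- This is the bound fed to duality, with `t = log ‖xⁿ‖`. -/
theorem neg_sum_le_log_norm_single {u : Fin d → ℝ} (hu : u ∈ Δ.carrier) (n : Fin d → ℤ) :
    -∑ j, (n j : ℝ) * u j ≤ Real.log ‖(single n 1 : LaurentAlgebra Δ)‖ := by
  rw [Real.le_log_iff_exp_le (norm_single_one_pos n)]
  simpa [weight] using le_norm_single hu n (1 : 𝕜)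

theorem abs_sub_floor_div_mul_le {l : ℝ} (hl : 0 ≤ l) {N : ℕ} (hN : 0 < N) :
    |l - ⌊l / N⌋₊ * N| ≤ N := by
  have hN' : (0 : ℝ) < N := by exact_mod_cast hN
  have h1 := (le_div_iff₀ hN').1 (Nat.floor_le (div_nonneg hl hN'.le))
  have h2 := (div_lt_iff₀ hN').1 (Nat.lt_floor_add_one (l / N))
  rw [abs_le]
  constructor <;> linarith

theorem exists_epimorphism (Δ : BoundedRationalPolyhedron 𝕜 d) :
    ∃ (m : ℕ) (φ : TateAlgebra 𝕜 m →ₐ[𝕜] LaurentAlgebra Δ),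
      Continuous φ ∧ Function.Surjective φ := by
  obtain ⟨r, b, c, hc, hΔ⟩ := Δ.rational
  obtain ⟨N, hN, a, ha⟩ := exists_common_nsmul_eq_neg_log_norm hc
  have ha_norm : ∀ i, ‖a i‖⁻¹ = Real.exp (N * c i) := fun i ↦ by
    rw [(ha i).2, Real.exp_neg, Real.exp_log (norm_pos_iff.2 (ha i).1)]
  -- the finite set of remainders
  set M : Fin d → ℤ := fun j ↦ 1 + ∑ i, N * |b i j| with hM
  set B : Finset (Fin d → ℤ) := Finset.Icc (-M) M
  -- An exact normalization of `x^p` may not exist in the base field; any small nonzero scalar will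
  -- do, since only the finitely many `p ∈ B` matter.
  have hδ : ∀ p : Fin d → ℤ, ∃ δ : 𝕜, 0 < ‖δ‖ ∧ ‖δ‖ * ‖(single p 1 : LaurentAlgebra Δ)‖ ≤ 1 := by
    intro p
    have hp := norm_single_one_pos (Δ := Δ) p
    obtain ⟨δ, h0, h1⟩ := NormedField.exists_norm_lt 𝕜 (inv_pos.2 hp)
    exact ⟨δ, h0, ((lt_inv_mul_iff₀' hp).1 (by simpa using h1)).le⟩
  choose δ hδ0 hδ1 using hδ
  -- In the constant, the exponential absorbs the duality error `1` and the rounding of each `l i`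
  -- against `c i`; the sum over `B` absorbs the scalar of whichever remainder occurs.
  refine exists_epimorphism_of_monomials (ι := Fin r ⊕ B)
    (Sum.elim (fun i ↦ single (N • b i) (a i)⁻¹) fun p ↦ single p.1 (δ p.1)) ?_
    (Real.exp (1 + ∑ i, N * |c i|) * ∑ p ∈ B, ‖δ p‖⁻¹) fun n ↦ ?_
  · rintro (i | p)
    · refine norm_single_le zero_le_one fun u hu ↦ ?_
      -- The norm bound is the `i`-th inequality of `Δ` multiplied by `N`.
      rw [norm_inv, ha_norm, weight, ← Real.exp_add, Real.exp_le_one_iff]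
      rw [hΔ] at hu
      have := mul_le_mul_of_nonneg_left (hu i) (Nat.cast_nonneg (α := ℝ) N)
      simp only [Pi.smul_apply, nsmul_eq_mul, Int.cast_mul, Int.cast_natCast, mul_assoc,
        ← Finset.mul_sum]
      linarith
    · rw [Sum.elim_inr, norm_single]
      exact hδ1 p.1
  · set t := Real.log ‖(single n 1 : LaurentAlgebra Δ)‖ with ht
    obtain ⟨l, hl, hln, hlc⟩ := exists_nonneg_combination (fun i j ↦ (b i j : ℝ)) c
      (hΔ ▸ Δ.nonempty) (hΔ ▸ Δ.bounded) (fun j ↦ (n j : ℝ)) t fun u hu ↦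
        neg_sum_le_log_norm_single (by rw [hΔ]; exact hu) n
    set q : Fin r → ℕ := fun i ↦ ⌊l i / N⌋₊ with hq
    have hrem : ∀ i, |l i - q i * N| ≤ N := fun i ↦ abs_sub_floor_div_mul_le (hl i) hN
    have hrem_mul : ∀ i (x : ℝ), |(l i - q i * N) * x| ≤ N * |x| := fun i x ↦ by
      rw [abs_mul]
      exact mul_le_mul_of_nonneg_right (hrem i) (abs_nonneg x)
    set p : Fin d → ℤ := n - ∑ i, q i • N • b i with hp
    have hpB : p ∈ B := by
      have habs : ∀ j, |p j| ≤ M j := by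
        intro j
        -- Duality error plus rounding error: the first is at most `1`, the second at most `∑ i, N *
        -- |b i j|`, which together give `M j`.
        have h1 : ((p j : ℤ) : ℝ) =
            (n j - ∑ i, l i * b i j) + ∑ i, (l i - q i * N) * b i j := by
          simp only [hp, Pi.sub_apply, Finset.sum_apply, nsmul_eq_mul, Pi.mul_apply, Pi.natCast_apply,
            Int.cast_sub, Int.cast_sum, Int.cast_mul, Int.cast_natCast, sub_mul, Finset.sum_sub_distrib,
            mul_assoc]
          ring
        have h2 : |((p j : ℤ) : ℝ)| ≤ 1 + ∑ i, N * |(b i j : ℝ)| := by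
          rw [h1]
          refine (abs_add_le _ _).trans (add_le_add (hln j) ?_)
          exact (Finset.abs_sum_le_sum_abs _ _).trans (Finset.sum_le_sum fun i _ ↦ hrem_mul i _)
        have h3 : ((|p j| : ℤ) : ℝ) ≤ ((M j : ℤ) : ℝ) := by
          rw [hM]
          push_cast
          exact h2
        exact_mod_cast h3
      exact Finset.mem_Icc.2 ⟨fun j ↦ (abs_le.1 (habs j)).1, fun j ↦ (abs_le.1 (habs j)).2⟩
    -- Each inequality generator is used `q i` times and the remainder generator for `p` exactly
    -- once.
    refine ⟨Sum.elim q (Pi.single ⟨p, hpB⟩ 1), (∏ i, ((a i)⁻¹) ^ q i) * δ p, ?_, ?_⟩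
    · rw [Fintype.prod_sum_type]
      simp only [Sum.elim_inl, Sum.elim_inr]
      rw [Fintype.prod_eq_single (⟨p, hpB⟩ : B) fun x hx ↦ by
        rw [Pi.single_eq_of_ne hx, pow_zero], Pi.single_eq_same, pow_one]
      simp only [single_pow]
      rw [prod_single, single_mul_single]
      congr 1
      rw [hp, add_sub_cancel]
    · have hnorm : ‖∏ i, ((a i)⁻¹) ^ q i‖ = Real.exp (∑ i, q i * (N * c i)) := by
        rw [norm_prod, Real.exp_sum]
        refine Finset.prod_congr rfl fun i _ ↦ ?_
        rw [norm_pow, norm_inv, ha_norm, ← Real.exp_nat_mul]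
      have hexp : ‖(single n 1 : LaurentAlgebra Δ)‖ = Real.exp t :=
        (Real.exp_log (norm_single_one_pos n)).symm
      rw [norm_single, norm_mul, hnorm, hexp]
      -- Replacing `l i` by `q i * N` changes `∑ i, l i * c i` by at most `∑ i, N * |c i|`, and
      -- `hlc` gives `0 ≤ 1 + t + ∑ i, l i * c i`.
      have hsum : 0 ≤ (1 + ∑ i, N * |c i|) + ((∑ i, q i * (N * c i)) + t) := by
        have h1 : ∑ i, (l i - q i * N) * c i ≤ ∑ i, N * |c i| :=
          Finset.sum_le_sum fun i _ ↦ (le_abs_self _).trans (hrem_mul i _)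
        simp only [sub_mul, Finset.sum_sub_distrib, mul_assoc] at h1
        linarith
      have hδp : 1 ≤ (∑ p ∈ B, ‖δ p‖⁻¹) * ‖δ p‖ := by
        rw [← inv_le_iff_one_le_mul₀ (hδ0 p)]
        exact Finset.single_le_sum (f := fun p ↦ ‖δ p‖⁻¹)
          (fun p _ ↦ inv_nonneg.2 (norm_nonneg _)) hpB
      calc (1 : ℝ) ≤ Real.exp ((1 + ∑ i, N * |c i|) + ((∑ i, q i * (N * c i)) + t)) *
            ((∑ p ∈ B, ‖δ p‖⁻¹) * ‖δ p‖) :=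
            one_le_mul_of_one_le_of_one_le (Real.one_le_exp hsum) hδp
        _ = _ := by rw [Real.exp_add, Real.exp_add (∑ i, _)]; ring

end LaurentAlgebra
end PolyhedralAffinoid

theorem mainTheorem10 {𝕜 : Type*} [NontriviallyNormedField 𝕜] [CompleteSpace 𝕜]
    [IsUltrametricDist 𝕜] {d : ℕ} (Δ : PolyhedralAffinoid.BoundedRationalPolyhedron 𝕜 d) :
    PolyhedralAffinoid.IsAffinoidAlgebra 𝕜 (PolyhedralAffinoid.LaurentAlgebra Δ) where
  complete := inferInstance
  ultrametric := inferInstance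
  norm_algebraMap := PolyhedralAffinoid.LaurentAlgebra.norm_algebraMap_eq
  exists_epimorphism := PolyhedralAffinoid.LaurentAlgebra.exists_epimorphism Δ
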